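/- **Setting.** Consider two-agent, two-action games with payoffs $u_1,u_2$. For choice distributions $x=(x_1,x_2)$ let $u_k(x)$ be the expected payoff of agent $k$, let $r_{ki}(x)=u_k(i;x_{-k})$, and let $r_k(x)=(r_{ki}(x))_i$. The smooth Q-learning dynamics are $$\frac{\dot x_{ki}}{x_{ki}}=\beta_k(t)\bigl[r_{ki}(x)-\langle x_k,r_k(x)\rangle\bigr]-\alpha_k(t)\bigl[\ln x_{ki}-\langle x_k,\ln x_k\rangle\bigr],$$ with adaptation rates $\beta_k(t)>0$ and memory-loss rates $\alpha_k(t)\ge 0$, which together form a policy. Trajectories are continuous, have full support, and satisfy the equation with right derivatives. The exploration rate of agent $k$ is $\delta_k(t)=\alpha_k(t)/\beta_k(t)$. Initial conditions are identified with $(p_1,p_2)\in(0,1)^2$, where $p_k$ is the probability with which agent $k$ plays the first action. **Theorem 4.1.** For every $M>0$ there are two $2\times2$ games $\Gamma_u$ and $\Gamma_v$, each of which is a symmetric ($u_2=u_1^T$) coordination game (for each agent, matching the other agent's action is the strict best response) and an exact potential game, measurable sets $I_u,I_v\subset(0,1)^2$ of positive Lebesgue measure, and thresholds $0<d_k\le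 D_k$, $k=1,2$, with the following properties. (a) For all $0<b\le B$ and $s\ge0$ there is $T>0$ such that the following holds in $\Gamma_u$. Take any two policies with all $\beta_k(t)\in[b,B]$ for $t\ge0$ and with $\lim_{t\to\infty}\delta_k(t)=0$ for both agents, such that * under the first (*exploit*), $\delta_k(t)<d_k$ for all $t\ge 0$ and both $k$; * under the second (*explore*), at least one agent $k$ has $\delta_k(t)\ge D_k$ for all $t\in[s,s+T]$ (nothing else is required of this agent or of the other one). Then, for any two trajectories under these policies that start from the same initial condition in $I_u$, the utilities $u_k^{\text{exploit}}(t)$ and $u_k^{\text{explore}}(t)$ of each agent $k$ converge to positive limits as $t\to\infty$, and $$\lim_{t\to\infty}\frac{u_k^{\text{exploit}}(t)}{u_k^{\text{explore}}(t)}\ \ge\ M ,$$ and the same bound holds for the limit of the ratio of the aggregate utilities (summed over the two agents). (b) The same holds for $\Gamma_v$ and $I_v$, with the same thresholds, with $\le 1/M$ in place of $\ge M$. (c) Exploration by a single agent suffices: in $\Gamma_u$ and in $\Gamma_v$, for each agent $k$ there are two policies with continuous rates and memory-loss rates in $[0,1)$ that differ only in $\alpha_k$, whose exploration rates tend to $0$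 for both agents, such that under the first one all exploration rates stay below the thresholds $d_j$, under the second one $\delta_k(t)\ge D_k$ at some time $t\ge0$, and from every initial condition in $I_u$ (resp. $I_v$) there are trajectories under both policies, whose limiting utilities satisfy the conclusion of (a) (resp. (b)). Thus, exploration, even by a single agent, can cause unbounded loss and unbounded gain. -/

import Mathlib

open Filter Topology MeasureTheory

/-- The payoffs of a finite game with agents `ι`, each with action set `A`: `u k a` is the
reward of agent `k` at the pure action profile `a`. -/
abbrev Game (ι A : Type*) := ι → (ι → A) → ℝ

/-- Expected reward `u_k(x)` of agent `k` at the profile `x` of choice distributions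
(`x l i` is the probability with which agent `l` chooses action `i`). -/
noncomputable def expectedPayoff {ι A : Type*} [Fintype ι] [DecidableEq ι] [Fintype A]
    (u : Game ι A) (k : ι) (x : ι → A → ℝ) : ℝ :=
  ∑ a : ι → A, u k a * ∏ l, x l (a l)

/-- Reward `r_{ki}(x) = u_k(i; x_{-k})` of the pure action `i` of agent `k` against `x_{-k}`. -/
noncomputable def actionReward {ι A : Type*} [Fintype ι] [DecidableEq ι] [Fintype A]
    [DecidableEq A] (u : Game ι A) (k : ι) (i : A) (x : ι → A → ℝ) : ℝ :=
  expectedPayoff u k (Function.update x k (Pi.single i 1))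

/-- `φ` is an exact potential of the game `u`. -/
def IsExactPotential {ι A : Type*} [DecidableEq ι] (u : Game ι A) (φ : (ι → A) → ℝ) : Prop :=
  ∀ (k : ι) (a : ι → A) (i j : A),
    u k (Function.update a k i) - u k (Function.update a k j) =
      φ (Function.update a k i) - φ (Function.update a k j)

/-- The game is an (exact) potential game. -/
def IsPotentialGame {ι A : Type*} [DecidableEq ι] (u : Game ι A) : Prop :=
  ∃ φ : (ι → A) → ℝ, IsExactPotential u φ

/-- A two-agent, two-action game is symmetric if the payoff matrix of the second agent is the
transpose of that of the first agent. -/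
def IsSymmetricGame (u : Game (Fin 2) (Fin 2)) : Prop :=
  ∀ i j : Fin 2, u 1 ![i, j] = u 0 ![j, i]

/-- A two-agent, two-action game is a coordination game if, for either agent, matching the
action of the other agent is the strictly best response. -/
def IsCoordinationGame (u : Game (Fin 2) (Fin 2)) : Prop :=
  (u 0 ![1, 0] < u 0 ![0, 0] ∧ u 0 ![0, 1] < u 0 ![1, 1]) ∧
    (u 1 ![0, 1] < u 1 ![0, 0] ∧ u 1 ![1, 0] < u 1 ![1, 1])

/-- An exploration-exploitation policy: for every agent `k` and time `t`, the memory-loss rate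
`α k t ≥ 0` and the adaptation rate `β k t > 0`. Only times `t ≥ 0` matter. -/
structure Policy (ι : Type*) where
  α : ι → ℝ → ℝ
  β : ι → ℝ → ℝ
  α_nonneg : ∀ k t, 0 ≤ α k t
  β_pos : ∀ k t, 0 < β k t

namespace Policy

/-- The exploration rate `δ_k(t) = α_k(t) / β_k(t)` of agent `k`. -/
noncomputable def rate {ι : Type*} (P : Policy ι) (k : ι) (t : ℝ) : ℝ := P.α k t / P.β k t

/-- The adaptation rates stay in `[b, B]`. -/
def AdaptsWithin {ι : Type*} (P : Policy ι) (b B : ℝ) : Prop :=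
  ∀ k, ∀ t, 0 ≤ t → b ≤ P.β k t ∧ P.β k t ≤ B

/-- Exploration eventually vanishes for all agents. -/
def Vanishes {ι : Type*} (P : Policy ι) : Prop :=
  ∀ k, Tendsto (P.rate k) atTop (𝓝 0)

/-- Exploration remains below the thresholds `d` at all times, for all agents. -/
def StaysBelow {ι : Type*} (P : Policy ι) (d : ι → ℝ) : Prop :=
  ∀ k, ∀ t, 0 ≤ t → P.rate k t < d k

/-- Some agent keeps the exploration rate at or above the threshold `D` throughout the time
interval `[s, s + T]`. Nothing is required of the other agents, or of other times. -/
def ExploresDuring {ι : Type*} (P : Policy ι) (D : ι → ℝ) (s T : ℝ) : Prop :=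
  ∃ k, ∀ t, s ≤ t → t ≤ s + T → D k ≤ P.rate k t

/-- All rates are continuous in time and all memory-loss rates are smaller than `1`. -/
def IsRegular {ι : Type*} (P : Policy ι) : Prop :=
  ∀ k, Continuous (P.α k) ∧ Continuous (P.β k) ∧ ∀ t, P.α k t < 1

end Policy

/-- `x` is a (full support) trajectory, for times `t ≥ 0`, of the smooth Q-learning dynamics
`ẋ_{ki} / x_{ki} = β_k [r_{ki}(x) - ⟨x_k, r_k(x)⟩] - α_k [ln x_{ki} - ⟨x_k, ln x_k⟩]`.
Derivatives are from the right, which allows for rates that jump; where the rates are continuous,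
this is the two-sided derivative. -/
structure IsSQLTrajectory {ι A : Type*} [Fintype ι] [DecidableEq ι] [Fintype A] [DecidableEq A]
    (u : Game ι A) (P : Policy ι) (x : ℝ → ι → A → ℝ) : Prop where
  pos : ∀ t, 0 ≤ t → ∀ k i, 0 < x t k i
  sum_eq_one : ∀ t, 0 ≤ t → ∀ k, ∑ i, x t k i = 1
  continuousOn : ContinuousOn x (Set.Ici 0)
  hasDeriv : ∀ t, 0 ≤ t → ∀ k i,
    HasDerivWithinAt (fun τ => x τ k i)
      (x t k i *
        (P.β k t * (actionReward u k i (x t) - ∑ j, x t k j * actionReward u k j (x t)) -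
          P.α k t * (Real.log (x t k i) - ∑ j, x t k j * Real.log (x t k j))))
      (Set.Ici t) t

/-- The profile of choice distributions in which agent `k` chooses the first action with
probability `p k` and the second action with probability `1 - p k`. -/
def mixedProfile (p : Fin 2 → ℝ) : Fin 2 → Fin 2 → ℝ := fun k => ![p k, 1 - p k]

/-- Along the trajectories `x` and `y`, the expected reward of every agent converges to a positive
limit, and the limit of the ratio of the rewards satisfies `R`: individually, for every agent, and
in the aggregate. -/
def LimitingRatio {ι A : Type*} [Fintype ι] [DecidableEq ι] [Fintype A]
    (u : Game ι A) (x y : ℝ → ι → A → ℝ) (R : ℝ → Prop) : Prop :=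
  ∃ a b : ι → ℝ,
    (∀ k, 0 < a k ∧ 0 < b k ∧
      Tendsto (fun t => expectedPayoff u k (x t)) atTop (𝓝 (a k)) ∧
      Tendsto (fun t => expectedPayoff u k (y t)) atTop (𝓝 (b k)) ∧
      Tendsto (fun t => expectedPayoff u k (x t) / expectedPayoff u k (y t)) atTop
        (𝓝 (a k / b k)) ∧
      R (a k / b k)) ∧
    Tendsto (fun t => (∑ k, expectedPayoff u k (x t)) / ∑ k, expectedPayoff u k (y t)) atTop
      (𝓝 ((∑ k, a k) / ∑ k, b k)) ∧
    R ((∑ k, a k) / ∑ k, b k)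

/-- For every starting time `s`, a sufficiently long phase, from time `s` on, with the exploration
rate of at least one agent above `D` makes the ratio of the limiting utilities (low exploration,
i.e. below `d`, over exploration) satisfy `R`, from every initial condition in `I`, provided that
exploration eventually vanishes. The length `T` of the phase depends only on `s` and on bounds for
the adaptation rates. -/
def ExplorationForces (u : Game (Fin 2) (Fin 2)) (I : Set (Fin 2 → ℝ)) (d D : Fin 2 → ℝ)
    (R : ℝ → Prop) : Prop :=
  ∀ b B : ℝ, 0 < b → b ≤ B → ∀ s : ℝ, 0 ≤ s → ∃ T : ℝ, 0 < T ∧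
    ∀ P Q : Policy (Fin 2), P.AdaptsWithin b B → Q.AdaptsWithin b B →
      P.Vanishes → Q.Vanishes → P.StaysBelow d → Q.ExploresDuring D s T →
      ∀ p ∈ I, ∀ x y : ℝ → Fin 2 → Fin 2 → ℝ,
        IsSQLTrajectory u P x → x 0 = mixedProfile p →
        IsSQLTrajectory u Q y → y 0 = mixedProfile p →
        LimitingRatio u x y R

/-- For each agent `k` there are two policies that differ in the memory-loss rate of agent `k` only,
the first with low exploration by everybody, the second with exploration by agent `k`, for which
trajectories exist and the ratio of limiting utilities satisfies `R` from every initial condition in `I`. -/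
def SingleAgentSuffices (u : Game (Fin 2) (Fin 2)) (I : Set (Fin 2 → ℝ)) (d D : Fin 2 → ℝ)
    (R : ℝ → Prop) : Prop :=
  ∀ k : Fin 2, ∃ P Q : Policy (Fin 2), P.IsRegular ∧ Q.IsRegular ∧
    Q.β = P.β ∧ (∀ j, j ≠ k → Q.α j = P.α j) ∧
    P.Vanishes ∧ Q.Vanishes ∧ P.StaysBelow d ∧ (∃ t, 0 ≤ t ∧ D k ≤ Q.rate k t) ∧
    ∀ p ∈ I, ∃ x y : ℝ → Fin 2 → Fin 2 → ℝ,
      IsSQLTrajectory u P x ∧ x 0 = mixedProfile p ∧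
      IsSQLTrajectory u Q y ∧ y 0 = mixedProfile p ∧
      LimitingRatio u x y R

/-!
In the symmetric game with payoff matrix `!![a, c - 2; a - 1, c]` the advantage of the first action
over the second, against an opponent who plays the first action with probability `q`, is `3 q - 2`,
whatever `a` and `c` are. So `a` and `c` set the payoffs of the two pure equilibria freely without
affecting the dynamics, and the second action is always risk dominant: it is the best reply to the
uniform choice `q = 1 / 2`. With `(a, c) = (M, 1)` the same change of equilibrium is a loss by the
factor `M`, with `(a, c) = (1, M)` a gain by it.

In the log-odds `z k = log (x k 0) - log (x k 1)` the smooth Q-learning dynamics become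
`z k' = β k * (3 σ (z l) - 2 - δ k * z k)`, where `l` is the other agent, `σ` the logistic function
and `δ k` the exploration rate.

* If `δ < 1 / 8`, the region `z ≥ 2` is forward invariant, and once exploration vanishes `z` tends
  to `+∞` in it (`IsLogOddsPath.tendsto_atTop`): both agents end up with the payoff `a`.
* If `δ k ≥ 8` for long enough, then `z k` is pushed below `1 / 4`, and the best reply of the other
  agent to such a choice is the second action, so that the log-odds of that agent fall below `1 / 4`
  too, at whatever rate that agent explores (`IsLogOddsPath.le_quarter_of_exploresDuring`). Since
  the second action is risk dominant, the region `z ≤ 1 / 4` is forward invariant under any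
  exploration rates, and `z` tends to `-∞` in it once exploration vanishes
  (`IsLogOddsPath.tendsto_atBot`): both agents end up with the payoff `c`.

The initial conditions are a box in which all log-odds lie between `2` and `3`. The upper bound and
the growth bound `IsLogOddsPath.le_add_mul` make the length of the exploration phase uniform.
Trajectories exist for all times because the vector field in log-odds is globally Lipschitz
(`exists_solution_Ici_of_lipschitz`).
-/

/-! ### Comparison principles for right derivatives -/

/-- Forward invariance of the orthant below `c`: it suffices that on its boundary the components
that equal `c` decrease. -/
theorem forall_le_of_deriv_right_neg {ι : Type*} [Finite ι] {f f' : ℝ → ι → ℝ} {a c : ℝ}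
    (hf : ∀ k, ContinuousOn (fun t => f t k) (Set.Ici a))
    (hf' : ∀ t, a ≤ t → ∀ k, HasDerivWithinAt (fun τ => f τ k) (f' t k) (Set.Ici t) t)
    {b : ℝ} (ha : ∀ k, f a k ≤ c)
    (hneg : ∀ t, a ≤ t → t < b → (∀ j, f t j ≤ c) → ∀ k, f t k = c → f' t k < 0) :
    ∀ t, a ≤ t → t ≤ b → ∀ k, f t k ≤ c := by
  have key : Set.Icc a b ⊆ {t | ∀ k, f t k ≤ c} := by
    apply IsClosed.Icc_subset_of_forall_exists_gt
    · have : {t | ∀ k, f t k ≤ c} ∩ Set.Icc a b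
          = Set.Icc a b ∩ ⋂ k, (Set.Icc a b ∩ (fun t => f t k) ⁻¹' Set.Iic c) := by
        ext t
        simp only [Set.mem_inter_iff, Set.mem_ofPred_eq, Set.mem_iInter, Set.mem_preimage,
          Set.mem_Iic]
        exact ⟨fun h => ⟨h.2, fun k => ⟨h.2, h.1 k⟩⟩, fun h => ⟨fun k => (h.2 k).2, h.1⟩⟩
      rw [this]
      exact isClosed_Icc.inter (isClosed_iInter fun k =>
        ((hf k).mono Set.Icc_subset_Ici_self).preimage_isClosed_of_isClosed isClosed_Icc
          isClosed_Iic)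
    · exact ha
    · rintro t ⟨htc, hta, htb⟩ y hy
      have hev : ∀ᶠ τ in 𝓝[>] t, ∀ k, f τ k ≤ c := by
        refine eventually_all.2 fun k => ?_
        rcases (htc k).lt_or_eq with hlt | heq
        · have hcont : ContinuousWithinAt (fun τ => f τ k) (Set.Ioi t) t :=
            ((hf' t hta k).continuousWithinAt).mono Set.Ioi_subset_Ici_self
          exact (hcont.eventually (gt_mem_nhds hlt)).mono fun _ h => h.le
        · have hslope := (hf' t hta k).mono Set.Ioi_subset_Ici_self
          rw [hasDerivWithinAt_iff_tendsto_slope' Set.self_notMem_Ioi] at hslope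
          filter_upwards [hslope.eventually (gt_mem_nhds (hneg t hta htb htc k heq)),
            self_mem_nhdsWithin] with τ hτ hτt
          have hpos : 0 < τ - t := sub_pos.2 hτt
          rw [slope_def_field, div_lt_iff₀ hpos, zero_mul] at hτ
          linarith
      obtain ⟨τ, h1, h2⟩ := (hev.and (Ioc_mem_nhdsGT hy)).exists
      exact ⟨τ, h1, h2⟩
  exact fun t h1 h2 => key ⟨h1, h2⟩

theorem le_of_deriv_right_neg {f f' : ℝ → ℝ} {a b c : ℝ}
    (hf : ContinuousOn f (Set.Ici a))
    (hf' : ∀ t, a ≤ t → HasDerivWithinAt f (f' t) (Set.Ici t) t) (ha : f a ≤ c)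
    (hneg : ∀ t, a ≤ t → t < b → f t = c → f' t < 0) :
    ∀ t, a ≤ t → t ≤ b → f t ≤ c := fun t h1 h2 =>
  forall_le_of_deriv_right_neg (ι := Unit) (f := fun t _ => f t) (f' := fun t _ => f' t)
    (fun _ => hf) (fun t ht _ => hf' t ht) (fun _ => ha)
    (fun t h1 h2 _ _ h => hneg t h1 h2 h) t h1 h2 ()

/-- A function that decreases at speed at least `η` while it is at or above `c` is at most `c` once
the time needed to descend from `H` to `c` has passed, and stays there. -/
theorem le_of_deriv_right_le_neg {f f' : ℝ → ℝ} {a b c η H : ℝ} (hη : 0 < η)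
    (hf : ContinuousOn f (Set.Ici a))
    (hf' : ∀ t, a ≤ t → HasDerivWithinAt f (f' t) (Set.Ici t) t) (ha : f a ≤ H)
    (hdec : ∀ t, a ≤ t → t < b → c ≤ f t → f' t ≤ -η) :
    ∀ t, a ≤ t → t ≤ b → H - c ≤ η * (t - a) → f t ≤ c := by
  intro t hat htb hlen
  by_contra! hct
  have habove : ∀ s, a ≤ s → s ≤ t → c < f s := by
    intro s has hst
    by_contra! hsc
    have hle := le_of_deriv_right_neg (b := b) (hf.mono (Set.Ici_subset_Ici.2 has))
      (fun τ hτ => hf' τ (has.trans hτ)) hsc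
      (fun τ h1 h2 h3 => (hdec τ (has.trans h1) h2 h3.ge).trans_lt (neg_lt_zero.2 hη)) t hst htb
    linarith
  have hdecay := image_le_of_deriv_right_le_deriv_boundary (f := f) (f' := f') (a := a) (b := t)
    (B := fun τ => H - η * (τ - a)) (B' := fun _ => -η)
    (hf.mono Set.Icc_subset_Ici_self) (fun τ hτ => hf' τ hτ.1) (by simpa using ha)
    (by fun_prop)
    (fun τ _ => by
      have := (((hasDerivAt_id τ).sub_const a).const_mul η).const_sub H
      simpa using this.hasDerivWithinAt)
    (fun τ hτ => hdec τ hτ.1 (hτ.2.trans_le htb) (habove τ hτ.1 hτ.2.le).le)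
    (Set.right_mem_Icc.2 hat)
  linarith

/-- A drift bounded above by `-η < 0`, up to a damping term `δ f` with vanishing rate, drives `f` to
`-∞`: below any given level `C` the damping is eventually too weak to balance the drift. -/
theorem tendsto_atBot_of_deriv_right_le {f f' β δ : ℝ → ℝ} {a b η : ℝ} (hη : 0 < η) (hb : 0 < b)
    (hf : ContinuousOn f (Set.Ici a))
    (hf' : ∀ t, a ≤ t → HasDerivWithinAt f (f' t) (Set.Ici t) t)
    (hβ : ∀ t, a ≤ t → b ≤ β t) (hδ : ∀ t, 0 ≤ δ t) (hδ0 : Tendsto δ atTop (𝓝 0))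
    (hle : ∀ t, a ≤ t → f' t ≤ β t * (-η - δ t * f t)) :
    Tendsto f atTop atBot := by
  refine tendsto_atBot.2 fun C => ?_
  set L := max 1 (-C) with hL
  have hL1 : 1 ≤ L := le_max_left _ _
  have hLC : -L ≤ C := by linarith [le_max_right 1 (-C)]
  have hsmall : ∀ᶠ t in atTop, δ t < η / (2 * L) :=
    hδ0.eventually (gt_mem_nhds (by positivity))
  obtain ⟨τ, hτ⟩ := (hsmall.and (eventually_ge_atTop a)).exists_forall_of_atTop
  have haτ : a ≤ τ := (hτ τ le_rfl).2
  have hη' : 0 < b * (η / 2) := by positivity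
  filter_upwards [eventually_ge_atTop τ,
    eventually_ge_atTop (τ + (f τ - -L) / (b * (η / 2)))] with t h1 h2
  refine le_trans ?_ hLC
  refine le_of_deriv_right_le_neg (b := t) hη' (hf.mono (Set.Ici_subset_Ici.2 haτ))
    (fun s hs => hf' s (haτ.trans hs)) le_rfl ?_ t h1 le_rfl ?_
  · intro s hs _ hfs
    refine (hle s (haτ.trans hs)).trans ?_
    have hδs := (hτ s hs).1
    rw [lt_div_iff₀ (by positivity)] at hδs
    -- Where `f s` is nonnegative the damping term only helps; otherwise `-f s ≤ L`.
    have h3 : -η - δ s * f s ≤ -(η / 2) := by nlinarith [hδ s]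
    have h4 := hβ s (haτ.trans hs)
    nlinarith
  · have h3 : (f τ - -L) / (b * (η / 2)) ≤ t - τ := by linarith
    rwa [div_le_iff₀ hη', mul_comm] at h3

/-! ### Global solutions of Lipschitz differential equations -/

open scoped NNReal in
/-- The length `h` of the interval of existence depends on the Lipschitz constant only, not on the
initial value, which is what allows solutions to be continued indefinitely. -/
theorem exists_solution_Icc_of_lipschitz {E : Type*} [NormedAddCommGroup E] [NormedSpace ℝ E]
    [CompleteSpace E] {f : ℝ → E → E} {K : ℝ≥0} (hK : ∀ t, LipschitzWith K (f t))
    (hc : ∀ x, Continuous fun t => f t x) (a : ℝ) {h : ℝ} (hh : 0 ≤ h) (hKh : K * h ≤ 1 / 2)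
    (x₀ : E) :
    ∃ z : ℝ → E, z a = x₀ ∧
      ∀ t ∈ Set.Icc a (a + h), HasDerivWithinAt z (f t (z t)) (Set.Icc a (a + h)) t := by
  obtain ⟨C, hC⟩ := isCompact_Icc.exists_bound_of_continuousOn
    (s := Set.Icc a (a + h)) (hc x₀).continuousOn
  have ha : a ∈ Set.Icc a (a + h) := ⟨le_rfl, by linarith⟩
  have hC0 : 0 ≤ C := (norm_nonneg _).trans (hC a ha)
  -- On the ball of radius `2 h C` the field is bounded by `C + K * (2 h C) ≤ 2 C`, so solutions do
  -- not leave the ball within time `h`.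
  let r : ℝ≥0 := ⟨2 * h * C, by positivity⟩
  let L : ℝ≥0 := ⟨2 * C, by positivity⟩
  have hpl : IsPicardLindelof f (tmin := a) (tmax := a + h) ⟨a, ha⟩ x₀ r 0 L K :=
    { lipschitzOnWith := fun t _ => (hK t).lipschitzOnWith
      continuousOn := fun x _ => (hc x).continuousOn
      norm_le := by
        intro t ht x hx
        have h1 := (hK t).dist_le_mul x x₀
        rw [dist_eq_norm] at h1
        have h2 : dist x x₀ ≤ 2 * h * C := hx
        have h3 : (K : ℝ) * dist x x₀ ≤ K * (2 * h * C) :=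
          mul_le_mul_of_nonneg_left h2 K.2
        have h4 := norm_le_norm_add_norm_sub (f t x₀) (f t x)
        rw [norm_sub_rev] at h4
        have h5 := hC t ht
        show ‖f t x‖ ≤ 2 * C
        nlinarith
      mul_max_le := by
        show 2 * C * max (a + h - a) (a - a) ≤ 2 * h * C - 0
        rw [add_sub_cancel_left, sub_self, max_eq_left hh]
        linarith }
  exact hpl.exists_eq_forall_mem_Icc_hasDerivWithinAt₀

open scoped NNReal in
/-- A time-dependent vector field that is continuous in time and globally Lipschitz in space has a
solution for all times `t ≥ 0` through every initial value. -/
theorem exists_solution_Ici_of_lipschitz {E : Type*} [NormedAddCommGroup E] [NormedSpace ℝ E]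
    [CompleteSpace E] {f : ℝ → E → E} {K : ℝ≥0} (hK : ∀ t, LipschitzWith K (f t))
    (hc : ∀ x, Continuous fun t => f t x) (x₀ : E) :
    ∃ z : ℝ → E, z 0 = x₀ ∧ ContinuousOn z (Set.Ici 0) ∧
      ∀ t, 0 ≤ t → HasDerivWithinAt z (f t (z t)) (Set.Ici t) t := by
  obtain ⟨h, hh, hKh⟩ : ∃ h : ℝ, 0 < h ∧ K * h ≤ 1 / 2 := by
    have hK0 : (0 : ℝ) ≤ K := K.2
    refine ⟨1 / (2 * (K + 1)), by positivity, ?_⟩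
    rw [mul_one_div, div_le_div_iff₀ (by positivity) (by positivity)]
    linarith
  have hstep : ∀ n : ℕ, ∃ z : ℝ → E, z 0 = x₀ ∧ ContinuousOn z (Set.Icc 0 (n * h)) ∧
      ∀ t ∈ Set.Ico 0 (n * h), HasDerivWithinAt z (f t (z t)) (Set.Ici t) t := by
    intro n
    induction n with
    | zero => exact ⟨fun _ => x₀, rfl, continuousOn_const, by simp⟩
    | succ n ih =>
      obtain ⟨z, hz0, hzc, hzd⟩ := ih
      set a : ℝ := n * h with ha
      have ha0 : 0 ≤ a := by positivity
      obtain ⟨w, hwa, hwd⟩ := exists_solution_Icc_of_lipschitz hK hc a hh.le hKh (z a)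
      have hna : ((n + 1 : ℕ) : ℝ) * h = a + h := by push_cast; ring
      rw [hna]
      have hwc : ContinuousOn w (Set.Icc a (a + h)) := fun t ht => (hwd t ht).continuousWithinAt
      let y : ℝ → E := fun t => if t ≤ a then z t else w t
      have hyz : ∀ t ≤ a, y t = z t := fun t ht => if_pos ht
      have hyw : ∀ t, a ≤ t → y t = w t := by
        intro t ht
        rcases ht.eq_or_lt with rfl | h'
        · rw [hyz _ le_rfl, hwa]
        · exact if_neg (not_le.2 h')
      refine ⟨y, by rw [hyz 0 ha0, hz0], ?_, ?_⟩
      · rw [← Set.Icc_union_Icc_eq_Icc ha0 (by linarith : a ≤ a + h)]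
        exact (hzc.congr fun t ht => hyz t ht.2).union_of_isClosed
          (hwc.congr fun t ht => hyw t ht.1) isClosed_Icc isClosed_Icc
      · rintro t ⟨ht0, hth⟩
        rcases lt_or_ge t a with hta | hta
        · rw [hyz t hta.le]
          refine (hzd t ⟨ht0, hta⟩).congr_of_eventuallyEq ?_ (hyz t hta.le)
          filter_upwards [nhdsWithin_le_nhds (gt_mem_nhds hta)] with s hs using hyz s hs.le
        · rw [hyw t hta]
          have hd : HasDerivWithinAt w (f t (w t)) (Set.Ici t) t :=
            (hwd t ⟨hta, hth.le⟩).mono_of_mem_nhdsWithin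
              (mem_of_superset (Icc_mem_nhdsGE hth) (Set.Icc_subset_Icc_left hta))
          exact hd.congr (fun s hs => hyw s (hta.trans hs)) (hyw t hta)
  -- The solutions on `[0, n h]` agree by uniqueness, hence glue to one on `[0, ∞)`.
  choose z hz0 hzc hzd using hstep
  have hagree : ∀ m n : ℕ, m ≤ n → ∀ t ∈ Set.Icc 0 (m * h), z m t = z n t := by
    intro m n hmn
    have hle : (m : ℝ) * h ≤ n * h := by gcongr
    exact ODE_solution_unique hK (hzc m) (hzd m) ((hzc n).mono (Set.Icc_subset_Icc_right hle))
      (fun t ht => hzd n t ⟨ht.1, ht.2.trans_le hle⟩) (by rw [hz0, hz0])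
  let N : ℝ → ℕ := fun t => ⌈t / h⌉₊
  have hN : ∀ t, t ≤ N t * h := fun t => (div_le_iff₀ hh).1 (Nat.le_ceil _)
  let y : ℝ → E := fun t => z (N t) t
  have hy : ∀ n : ℕ, ∀ t ∈ Set.Icc 0 (n * h), y t = z n t := by
    intro n t ht
    rcases le_total (N t) n with hle | hle
    · exact hagree _ _ hle t ⟨ht.1, hN t⟩
    · exact (hagree _ _ hle t ht).symm
  have hlt : ∀ t, t < (N t + 1 : ℕ) * h := by
    intro t
    have := hN t
    push_cast
    linarith
  refine ⟨y, by rw [hy 0 0 (by simp), hz0], ?_, ?_⟩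
  · intro t ht
    have ht0 : 0 ≤ t := ht
    have h1 := (hzc (N t + 1)).congr (hy (N t + 1)) t ⟨ht0, (hlt t).le⟩
    refine h1.mono_of_mem_nhdsWithin ?_
    rw [← Set.Ici_inter_Iic]
    exact inter_mem self_mem_nhdsWithin (nhdsWithin_le_nhds (Iic_mem_nhds (hlt t)))
  · intro t ht
    have hyt := hy (N t + 1) t ⟨ht, (hlt t).le⟩
    rw [hyt]
    refine (hzd (N t + 1) t ⟨ht, hlt t⟩).congr_of_eventuallyEq ?_ hyt
    filter_upwards [self_mem_nhdsWithin, nhdsWithin_le_nhds (gt_mem_nhds (hlt t))] with s hs hs'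
    exact hy _ s ⟨ht.trans hs, hs'.le⟩

/-! ### The games and their dynamics in log-odds -/

/-- The symmetric game in which an agent earns the `(i, j)` entry of the matrix by playing `i`
against `j`. The two agents are `0` and `1`, so the opponent of `k` is `1 - k`. The gain from
matching the opponent is `1` for the first action and `2` for the second, so the second one is risk
dominant, while the equilibrium payoffs `a` and `c` are arbitrary. -/
def riskGame (a c : ℝ) : Game (Fin 2) (Fin 2) :=
  fun k s => !![a, c - 2; a - 1, c] (s k) (s (1 - k))

theorem isPotentialGame_riskGame (a c : ℝ) : IsPotentialGame (riskGame a c) := by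
  refine ⟨fun s => !![1, 0; 0, 2] (s 0) (s 1), fun k s i j => ?_⟩
  generalize hs : s (1 - k) = m
  fin_cases k <;> fin_cases i <;> fin_cases j <;> fin_cases m <;>
    simp_all [riskGame, Function.update]

theorem isSymmetricGame_riskGame (a c : ℝ) : IsSymmetricGame (riskGame a c) := by
  intro i j
  simp [riskGame]

theorem isCoordinationGame_riskGame (a c : ℝ) : IsCoordinationGame (riskGame a c) := by
  simp [IsCoordinationGame, riskGame]

theorem expectedPayoff_fin_two (u : Game (Fin 2) (Fin 2)) (k : Fin 2) (x : Fin 2 → Fin 2 → ℝ) :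
    expectedPayoff u k x = ∑ i, ∑ j, u k ![i, j] * (x 0 i * x 1 j) := by
  rw [expectedPayoff, ← (finTwoArrowEquiv (Fin 2)).symm.sum_comp, Fintype.sum_prod_type]
  simp [Fin.prod_univ_two]

/-- The advantage of the first action does not involve the equilibrium payoffs `a` and `c`. -/
theorem actionReward_zero_sub_one_riskGame (a c : ℝ) (k : Fin 2) (x : Fin 2 → Fin 2 → ℝ) :
    actionReward (riskGame a c) k 0 x - actionReward (riskGame a c) k 1 x =
      x (1 - k) 0 - 2 * x (1 - k) 1 := by
  fin_cases k <;>
    simp [actionReward, expectedPayoff_fin_two, riskGame, Function.update, Pi.single_apply] <;>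
    ring

/-- The log-odds of agent `k` for the first action against the second. -/
noncomputable def logOdds (x : Fin 2 → Fin 2 → ℝ) (k : Fin 2) : ℝ :=
  Real.log (x k 0) - Real.log (x k 1)

theorem sigmoid_log_sub_log {p q : ℝ} (hp : 0 < p) (hq : 0 < q) (h : p + q = 1) :
    Real.sigmoid (Real.log p - Real.log q) = p := by
  rw [Real.sigmoid_def, neg_sub, Real.exp_sub, Real.exp_log hp, Real.exp_log hq]
  field_simp
  linarith

theorem logOdds_mixedProfile_sigmoid (z : Fin 2 → ℝ) :
    logOdds (mixedProfile fun k => Real.sigmoid (z k)) = z := by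
  funext k
  have h1 := Real.sigmoid_pos (z k)
  have h2 := Real.sigmoid_lt_one (z k)
  apply Real.sigmoid_injective
  simpa [logOdds, mixedProfile] using sigmoid_log_sub_log h1 (sub_pos.2 h2) (by ring)

theorem mixedProfile_sigmoid_logOdds {x : Fin 2 → Fin 2 → ℝ} (hpos : ∀ k i, 0 < x k i)
    (hsum : ∀ k, ∑ i, x k i = 1) : mixedProfile (fun k => Real.sigmoid (logOdds x k)) = x := by
  funext k i
  have h := hsum k
  rw [Fin.sum_univ_two] at h
  have h0 := sigmoid_log_sub_log (hpos k 0) (hpos k 1) h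
  fin_cases i
  · simpa [mixedProfile, logOdds] using h0
  · simp only [mixedProfile, logOdds, h0]
    simp
    linarith

/-- `z` solves, for times `t ≥ 0` and with right derivatives, the smooth Q-learning dynamics of
`riskGame a c` written in log-odds. The equation does not involve `a` and `c`. -/
structure IsLogOddsPath (P : Policy (Fin 2)) (z : ℝ → Fin 2 → ℝ) : Prop where
  continuousOn : ContinuousOn z (Set.Ici 0)
  hasDeriv : ∀ t, 0 ≤ t → ∀ k, HasDerivWithinAt (fun τ => z τ k)
    (P.β k t * (3 * Real.sigmoid (z t (1 - k)) - 2) - P.α k t * z t k) (Set.Ici t) t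

theorem IsSQLTrajectory.isLogOddsPath {a c : ℝ} {P : Policy (Fin 2)} {x : ℝ → Fin 2 → Fin 2 → ℝ}
    (hx : IsSQLTrajectory (riskGame a c) P x) : IsLogOddsPath P fun t => logOdds (x t) where
  continuousOn := by
    have hc : ∀ k i, ContinuousOn (fun t => Real.log (x t k i)) (Set.Ici 0) := fun k i =>
      ((continuousOn_pi.1 (continuousOn_pi.1 hx.continuousOn k)) i).log
        fun t ht => (hx.pos t ht k i).ne'
    exact continuousOn_pi.2 fun k => (hc k 0).sub (hc k 1)
  hasDeriv := by
    intro t ht k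
    have h0 := (hx.hasDeriv t ht k 0).log (hx.pos t ht k 0).ne'
    have h1 := (hx.hasDeriv t ht k 1).log (hx.pos t ht k 1).ne'
    rw [mul_div_cancel_left₀ _ (hx.pos t ht k _).ne'] at h0 h1
    refine (h0.sub h1).congr_deriv ?_
    have hs := hx.sum_eq_one t ht (1 - k)
    rw [Fin.sum_univ_two] at hs
    have hq : Real.sigmoid (logOdds (x t) (1 - k)) = x t (1 - k) 0 :=
      sigmoid_log_sub_log (hx.pos t ht _ 0) (hx.pos t ht _ 1) hs
    have hr := actionReward_zero_sub_one_riskGame a c k (x t)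
    rw [hq, logOdds]
    linear_combination P.β k t * hr - 2 * P.β k t * hs

theorem IsLogOddsPath.isSQLTrajectory {P : Policy (Fin 2)} {z : ℝ → Fin 2 → ℝ}
    (hz : IsLogOddsPath P z) (a c : ℝ) :
    IsSQLTrajectory (riskGame a c) P fun t => mixedProfile fun k => Real.sigmoid (z t k) where
  pos := by
    intro t _ k i
    have h1 := Real.sigmoid_pos (z t k)
    have h2 := Real.sigmoid_lt_one (z t k)
    fin_cases i <;> simp [mixedProfile, h1, h2]
  sum_eq_one := by
    intro t _ k
    simp [mixedProfile]
  continuousOn := by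
    have hc : ∀ k, ContinuousOn (fun t => Real.sigmoid (z t k)) (Set.Ici 0) := fun k =>
      continuous_sigmoid.comp_continuousOn (continuousOn_pi.1 hz.continuousOn k)
    refine continuousOn_pi.2 fun k => continuousOn_pi.2 fun i => ?_
    fin_cases i
    · simpa [mixedProfile] using hc k
    · exact continuousOn_const.sub (hc k)
  hasDeriv := by
    intro t ht k i
    have hd := HasDerivAt.comp_hasDerivWithinAt (h₂ := Real.sigmoid) (h := fun τ => z τ k) t
      (Real.hasDerivAt_sigmoid (z t k)) (hz.hasDeriv t ht k)
    have hr := actionReward_zero_sub_one_riskGame a c k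
      (mixedProfile fun k => Real.sigmoid (z t k))
    have hl := congrFun (logOdds_mixedProfile_sigmoid (z t)) k
    simp only [logOdds, mixedProfile, Matrix.cons_val_zero, Matrix.cons_val_one] at hl
    simp only [mixedProfile, Matrix.cons_val_zero, Matrix.cons_val_one] at hr
    fin_cases i
    · simp only [mixedProfile, Fin.sum_univ_two, Fin.zero_eta, Matrix.cons_val_zero, Matrix.cons_val_one]
      refine hd.congr_deriv ?_
      set q := Real.sigmoid (z t k)
      linear_combination -P.β k t * q * (1 - q) * hr + P.α k t * q * (1 - q) * hl
    · simp only [mixedProfile, Fin.sum_univ_two, Fin.mk_one, Matrix.cons_val_zero, Matrix.cons_val_one]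
      refine (hd.const_sub 1).congr_deriv ?_
      set q := Real.sigmoid (z t k)
      linear_combination P.β k t * q * (1 - q) * hr - P.α k t * q * (1 - q) * hl

theorem tendsto_expectedPayoff {ι A : Type*} [Fintype ι] [DecidableEq ι] [Fintype A] {X : Type*}
    {l : Filter X} (u : Game ι A) (k : ι) {x : X → ι → A → ℝ} {y : ι → A → ℝ}
    (h : ∀ j i, Tendsto (fun t => x t j i) l (𝓝 (y j i))) :
    Tendsto (fun t => expectedPayoff u k (x t)) l (𝓝 (expectedPayoff u k y)) :=
  tendsto_finsetSum _ fun s _ => (tendsto_finsetProd _ fun j _ => h j (s j)).const_mul _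

/-- If all agents converge to the same pure action, then every payoff converges to that of the
corresponding equilibrium: `q = 1` stands for the first action and `q = 0` for the second. -/
theorem tendsto_expectedPayoff_riskGame {X : Type*} {l : Filter X} {a c q : ℝ}
    {x : X → Fin 2 → Fin 2 → ℝ} (hq : q = 0 ∨ q = 1)
    (h : ∀ j, Tendsto (fun t => x t j 0) l (𝓝 q)) (hsum : ∀ᶠ t in l, ∀ k, ∑ i, x t k i = 1)
    (k : Fin 2) :
    Tendsto (fun t => expectedPayoff (riskGame a c) k (x t)) l (𝓝 (q * a + (1 - q) * c)) := by
  have hlim : ∀ j i, Tendsto (fun t => x t j i) l (𝓝 (mixedProfile (fun _ => q) j i)) := by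
    intro j i
    fin_cases i
    · simpa [mixedProfile] using h j
    · refine Tendsto.congr' (hsum.mono fun t ht => ?_) ((h j).const_sub 1)
      have := ht j
      rw [Fin.sum_univ_two] at this
      show 1 - x t j 0 = x t j 1
      linarith
  convert tendsto_expectedPayoff (riskGame a c) k hlim using 2
  rcases hq with rfl | rfl <;> fin_cases k <;>
    simp [expectedPayoff_fin_two, riskGame, mixedProfile]

open scoped NNReal in
theorem exists_isLogOddsPath (P : Policy (Fin 2)) (hP : P.IsRegular) {B : ℝ}
    (hB : ∀ k t, P.β k t ≤ B) (z₀ : Fin 2 → ℝ) :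
    ∃ z : ℝ → Fin 2 → ℝ, z 0 = z₀ ∧ IsLogOddsPath P z := by
  have hB0 : 0 ≤ B := (P.β_pos 0 0).le.trans (hB 0 0)
  have hσ : LipschitzWith 1 Real.sigmoid := by
    refine lipschitzWith_of_nnnorm_deriv_le differentiable_sigmoid fun x => ?_
    rw [← NNReal.coe_le_coe, coe_nnnorm, Real.deriv_sigmoid, Real.norm_eq_abs, abs_le]
    have h1 := Real.sigmoid_pos x
    have h2 := Real.sigmoid_lt_one x
    constructor <;> push_cast <;> nlinarith
  let f : ℝ → (Fin 2 → ℝ) → Fin 2 → ℝ := fun t z k =>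
    P.β k t * (3 * Real.sigmoid (z (1 - k)) - 2) - P.α k t * z k
  let K : ℝ≥0 := ⟨B * 3 + 1, by positivity⟩
  have hK : ∀ t, LipschitzWith K (f t) := by
    intro t
    refine LipschitzWith.of_dist_le_mul fun z w => (dist_pi_le_iff (by positivity)).2 fun k => ?_
    have h1 := hσ.dist_le_mul (z (1 - k)) (w (1 - k))
    have h2 := dist_le_pi_dist z w (1 - k)
    have h3 := dist_le_pi_dist z w k
    have h4 := hB k t
    have h5 := (hP k).2.2 t
    have h6 := P.β_pos k t
    have h7 := P.α_nonneg k t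
    rw [Real.dist_eq] at h1 h3 ⊢
    simp only [NNReal.coe_one, one_mul] at h1
    have h8 : |Real.sigmoid (z (1 - k)) - Real.sigmoid (w (1 - k))| ≤ dist z w := h1.trans h2
    have h9 : f t z k - f t w k = P.β k t * 3 *
        (Real.sigmoid (z (1 - k)) - Real.sigmoid (w (1 - k))) - P.α k t * (z k - w k) := by
      simp only [f]
      ring
    rw [h9]
    show _ ≤ (B * 3 + 1) * dist z w
    refine (abs_sub _ _).trans ?_
    rw [abs_mul, abs_of_nonneg (by positivity : 0 ≤ P.β k t * 3), abs_mul, abs_of_nonneg h7,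
      add_mul, one_mul]
    have := dist_nonneg (x := z) (y := w)
    refine add_le_add (mul_le_mul (by linarith) h8 (abs_nonneg _) (by positivity)) ?_
    nlinarith
  have hc : ∀ z, Continuous fun t => f t z := fun z => continuous_pi fun k =>
    ((hP k).2.1.mul continuous_const).sub ((hP k).1.mul continuous_const)
  obtain ⟨z, h0, hzc, hzd⟩ := exists_solution_Ici_of_lipschitz hK hc z₀
  exact ⟨z, h0, hzc, fun t ht k => hasDerivWithinAt_pi.1 (hzd t ht) k⟩

/-! ### The basins of the two equilibria -/

/-- Against an opponent with log-odds at most `1 / 4`, the second action is the better one. The bound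
`1 / 4` is positive, so an agent pushed towards the uniform choice by exploration gets below it. -/
theorem sigmoid_le_of_le_quarter {z : ℝ} (hz : z ≤ 1 / 4) : 3 * Real.sigmoid z - 2 ≤ -(1 / 4) := by
  have h1 := Real.add_one_le_exp (-z)
  have h2 : Real.sigmoid z ≤ 7 / 12 := by
    rw [Real.sigmoid_def]
    exact inv_le_of_inv_le₀ (by norm_num) (by norm_num; linarith)
  linarith

theorem le_sigmoid_of_two_le {z : ℝ} (hz : 2 ≤ z) : 1 / 2 ≤ 3 * Real.sigmoid z - 2 := by
  have h1 : Real.exp (-z) ≤ 1 / 5 := by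
    rw [Real.exp_neg, one_div]
    refine inv_anti₀ (by norm_num) ?_
    have := Real.quadratic_le_exp_of_nonneg (by norm_num : (0 : ℝ) ≤ 2)
    exact le_trans (by norm_num at this; exact this) (Real.exp_le_exp.2 hz)
  have h2 : 5 / 6 ≤ Real.sigmoid z := by
    rw [Real.sigmoid_def]
    exact le_inv_of_le_inv₀ (by positivity) (by norm_num; linarith)
  linarith

theorem Policy.rate_mul {ι : Type*} (P : Policy ι) (k : ι) (t : ℝ) :
    P.β k t * P.rate k t = P.α k t :=
  mul_div_cancel₀ _ (P.β_pos k t).ne'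

theorem Policy.rate_nonneg {ι : Type*} (P : Policy ι) (k : ι) (t : ℝ) : 0 ≤ P.rate k t :=
  div_nonneg (P.α_nonneg k t) (P.β_pos k t).le

namespace IsLogOddsPath

variable {P : Policy (Fin 2)} {z : ℝ → Fin 2 → ℝ} {b B : ℝ}

theorem hasDeriv_rate (hz : IsLogOddsPath P z) {t : ℝ} (ht : 0 ≤ t) (k : Fin 2) :
    HasDerivWithinAt (fun τ => z τ k)
      (P.β k t * (3 * Real.sigmoid (z t (1 - k)) - 2 - P.rate k t * z t k)) (Set.Ici t) t :=
  (hz.hasDeriv t ht k).congr_deriv (by rw [← P.rate_mul k t]; ring)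

theorem continuousOn_apply (hz : IsLogOddsPath P z) {a : ℝ} (ha : 0 ≤ a) (k : Fin 2) :
    ContinuousOn (fun t => z t k) (Set.Ici a) :=
  (continuousOn_pi.1 hz.continuousOn k).mono (Set.Ici_subset_Ici.2 ha)

/-- With little exploration, an initial preference of both agents for the first action is
self-reinforcing. -/
theorem tendsto_atTop (hz : IsLogOddsPath P z) (hb : 0 < b) (hP : P.AdaptsWithin b B)
    (hv : P.Vanishes) (hd : P.StaysBelow fun _ => 1 / 8) (h0 : ∀ k, 2 ≤ z 0 k) (k : Fin 2) :
    Tendsto (fun t => z t k) atTop atTop := by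
  have hge : ∀ t, 0 ≤ t → ∀ k, 2 ≤ z t k := by
    intro t ht k
    have := forall_le_of_deriv_right_neg (f := fun t k => -z t k) (c := -2) (b := t)
      (fun k => (hz.continuousOn_apply le_rfl k).neg)
      (fun t ht k => (hz.hasDeriv_rate ht k).neg) (fun k => neg_le_neg (h0 k))
      (fun s hs _ hle k hk => by
        have hk2 : z s k = 2 := neg_injective hk
        have h1 := le_sigmoid_of_two_le (neg_le_neg_iff.1 (hle (1 - k)))
        have h2 : P.rate k s < 1 / 8 := hd k s hs
        rw [hk2]
        exact neg_lt_zero.2 (mul_pos (P.β_pos k s) (by linarith))) t ht le_rfl k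
    linarith
  refine tendsto_neg_atBot_iff.1 (tendsto_atBot_of_deriv_right_le (η := 1 / 2) (a := 0)
    (by norm_num) hb (hz.continuousOn_apply le_rfl k).neg
    (fun t ht => (hz.hasDeriv_rate ht k).neg) (fun t ht => (hP k t ht).1)
    (P.rate_nonneg k) (hv k) fun t ht => ?_)
  have h1 := le_sigmoid_of_two_le (hge t ht (1 - k))
  rw [← mul_neg]
  exact mul_le_mul_of_nonneg_left (by linarith) (P.β_pos k t).le

/-- Log-odds grow at most linearly, at whatever rates the agents explore: damping can only lower
positive log-odds. -/
theorem le_add_mul (hz : IsLogOddsPath P z) (hP : P.AdaptsWithin b B) (hB : 0 ≤ B) {c : ℝ}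
    (hc : 0 ≤ c) (h0 : ∀ k, z 0 k ≤ c) {t : ℝ} (ht : 0 ≤ t) (k : Fin 2) :
    z t k ≤ c + (B + 1) * t := by
  have h := le_of_deriv_right_neg (f := fun τ => z τ k - (B + 1) * τ) (a := 0) (b := t) (c := c)
    ((hz.continuousOn_apply le_rfl k).sub (by fun_prop))
    (fun τ hτ => (hz.hasDeriv_rate hτ k).sub
      ((hasDerivAt_id τ).const_mul (B + 1)).hasDerivWithinAt) (by simpa using h0 k)
    (fun τ hτ _ heq => by
      have hz0 : 0 ≤ z τ k := by nlinarith
      have h1 := Real.sigmoid_lt_one (z τ (1 - k))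
      have h2 := P.β_pos k τ
      have h3 := (hP k τ hτ).2
      have h4 := mul_nonneg (P.rate_nonneg k τ) hz0
      nlinarith) t ht le_rfl
  linarith

/-- Once both agents have log-odds at most `1 / 4`, they stay there under any exploration rates,
since the second action is risk dominant, and end up playing it when exploration vanishes. -/
theorem tendsto_atBot (hz : IsLogOddsPath P z) (hb : 0 < b) (hP : P.AdaptsWithin b B)
    (hv : P.Vanishes) {τ : ℝ} (hτ : 0 ≤ τ) (h0 : ∀ k, z τ k ≤ 1 / 4) (k : Fin 2) :
    Tendsto (fun t => z t k) atTop atBot := by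
  have hle : ∀ t, τ ≤ t → ∀ k, z t k ≤ 1 / 4 := fun t ht =>
    forall_le_of_deriv_right_neg (b := t) (fun k => hz.continuousOn_apply hτ k)
      (fun t ht k => hz.hasDeriv_rate (hτ.trans ht) k) h0
      (fun s hs _ hle k hk => by
        have h1 := sigmoid_le_of_le_quarter (hle (1 - k))
        have h2 := P.rate_nonneg k s
        rw [hk]
        exact mul_neg_of_pos_of_neg (P.β_pos k s) (by linarith)) t ht le_rfl
  refine tendsto_atBot_of_deriv_right_le (η := 1 / 4) (a := τ) (by norm_num) hb
    (hz.continuousOn_apply hτ k) (fun t ht => hz.hasDeriv_rate (hτ.trans ht) k)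
    (fun t ht => (hP k t (hτ.trans ht)).1) (P.rate_nonneg k) (hv k) fun t ht => ?_
  have h1 := sigmoid_le_of_le_quarter (hle t ht (1 - k))
  exact mul_le_mul_of_nonneg_left (by linarith) (P.β_pos k t).le

/-- Sufficiently long exploration by one agent brings the log-odds of both agents below `1 / 4`. The
explorer gets there within time `T₁`, and the other agent, who responds to the explorer, within a
further time `T₂`. -/
theorem le_quarter_of_exploresDuring (hz : IsLogOddsPath P z) (hb : 0 < b)
    (hP : P.AdaptsWithin b B) (hB : 0 ≤ B) {c s T₁ T₂ : ℝ} (hc : 0 ≤ c)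
    (h0 : ∀ k, z 0 k ≤ c) (hs : 0 ≤ s) (hT₁ : 0 ≤ T₁) (hT₂ : 0 ≤ T₂)
    (h₁ : c + (B + 1) * s ≤ b * T₁) (h₂ : 4 * (c + (B + 1) * (s + T₁)) ≤ b * T₂)
    (hex : P.ExploresDuring (fun _ => 8) s (T₁ + T₂)) (k : Fin 2) :
    z (s + (T₁ + T₂)) k ≤ 1 / 4 := by
  obtain ⟨l, hl⟩ := hex
  have hl' : ∀ t, s + T₁ ≤ t → t ≤ s + (T₁ + T₂) → z t l ≤ 1 / 4 := by
    intro t ht1 ht2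
    refine le_of_deriv_right_le_neg (b := s + (T₁ + T₂)) hb (hz.continuousOn_apply hs l)
      (fun t ht => hz.hasDeriv_rate (hs.trans ht) l) (hz.le_add_mul hP hB hc h0 hs l)
      (fun t h1 h2 h3 => ?_) t (by linarith) ht2 (by nlinarith)
    have h4 := hl t h1 h2.le
    have h5 := Real.sigmoid_lt_one (z t (1 - l))
    have h6 := (hP l t (hs.trans h1)).1
    -- Above `1 / 4` the damping `8 * (1 / 4)` outweighs the advantage, which is less than `1`.
    have h7 : 3 * Real.sigmoid (z t (1 - l)) - 2 - P.rate l t * z t l ≤ -1 := by nlinarith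
    nlinarith
  by_cases hkl : k = l
  · exact hkl ▸ hl' _ (by linarith) le_rfl
  have hother : ∀ i j : Fin 2, i ≠ j → 1 - i = j := by decide
  have hk : 1 - k = l := hother k l hkl
  have hs' : 0 ≤ s + T₁ := by linarith
  refine le_of_deriv_right_le_neg (b := s + (T₁ + T₂)) (η := b / 4) (by positivity)
    (hz.continuousOn_apply hs' k)
    (fun t ht => hz.hasDeriv_rate (hs'.trans ht) k) (hz.le_add_mul hP hB hc h0 hs' k)
    (fun t h1 h2 h3 => ?_) _ (by linarith) le_rfl (by nlinarith)
  have h4 := sigmoid_le_of_le_quarter (hl' t h1 h2.le)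
  have h5 := mul_nonneg (P.rate_nonneg k t) (by linarith : 0 ≤ z t k)
  have h6 := (hP k t (hs'.trans h1)).1
  rw [hk]
  nlinarith

end IsLogOddsPath

/-! ### Limiting payoffs and policies -/

theorem limitingRatio_riskGame {a c : ℝ} (ha : 0 < a) (hc : 0 < c) {P Q : Policy (Fin 2)}
    {x y : ℝ → Fin 2 → Fin 2 → ℝ} (hx : IsSQLTrajectory (riskGame a c) P x)
    (hy : IsSQLTrajectory (riskGame a c) Q y)
    (hx' : ∀ k, Tendsto (fun t => logOdds (x t) k) atTop atTop)
    (hy' : ∀ k, Tendsto (fun t => logOdds (y t) k) atTop atBot) {R : ℝ → Prop} (hR : R (a / c)) :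
    LimitingRatio (riskGame a c) x y R := by
  have hfirst : ∀ {P : Policy (Fin 2)} {x}, IsSQLTrajectory (riskGame a c) P x →
      ∀ k, (fun t => Real.sigmoid (logOdds (x t) k)) =ᶠ[atTop] fun t => x t k 0 := by
    intro P x hx k
    filter_upwards [eventually_ge_atTop 0] with t ht
    have := hx.sum_eq_one t ht k
    rw [Fin.sum_univ_two] at this
    exact sigmoid_log_sub_log (hx.pos t ht k 0) (hx.pos t ht k 1) this
  have hxl : ∀ k, Tendsto (fun t => expectedPayoff (riskGame a c) k (x t)) atTop (𝓝 a) := by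
    intro k
    simpa using tendsto_expectedPayoff_riskGame (a := a) (c := c) (Or.inr rfl)
      (fun j => (Real.tendsto_sigmoid_atTop.comp (hx' j)).congr' (hfirst hx j))
      ((eventually_ge_atTop 0).mono hx.sum_eq_one) k
  have hyl : ∀ k, Tendsto (fun t => expectedPayoff (riskGame a c) k (y t)) atTop (𝓝 c) := by
    intro k
    simpa using tendsto_expectedPayoff_riskGame (a := a) (c := c) (Or.inl rfl)
      (fun j => (Real.tendsto_sigmoid_atBot.comp (hy' j)).congr' (hfirst hy j))
      ((eventually_ge_atTop 0).mono hy.sum_eq_one) k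
  refine ⟨fun _ => a, fun _ => c, fun k => ⟨ha, hc, hxl k, hyl k, (hxl k).div (hyl k) hc.ne', hR⟩,
    (tendsto_finsetSum _ fun k _ => hxl k).div (tendsto_finsetSum _ fun k _ => hyl k) ?_, ?_⟩
  · simpa using hc.ne'
  · simpa [mul_div_mul_left] using hR

/-- Initial conditions under which both agents play the first action with probability between `9 / 10`
and `19 / 20`. -/
def initialBox : Set (Fin 2 → ℝ) := Set.univ.pi fun _ => Set.Ioo (9 / 10) (19 / 20)

theorem measurableSet_initialBox : MeasurableSet initialBox :=
  MeasurableSet.univ_pi fun _ => measurableSet_Ioo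

theorem volume_initialBox_pos : 0 < volume initialBox := by
  rw [initialBox, Real.volume_pi_Ioo]
  exact (CanonicallyOrderedAdd.prod_pos).2 fun _ _ => ENNReal.ofReal_pos.2 (by norm_num)

theorem pos_and_lt_one_of_mem_initialBox {p : Fin 2 → ℝ} (hp : p ∈ initialBox) (k : Fin 2) :
    0 < p k ∧ p k < 1 := by
  obtain ⟨h1, h2⟩ := hp k trivial
  constructor <;> linarith

theorem logOdds_mem_Icc_of_mem_initialBox {p : Fin 2 → ℝ} (hp : p ∈ initialBox) (k : Fin 2) :
    logOdds (mixedProfile p) k ∈ Set.Icc 2 3 := by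
  obtain ⟨h1, h2⟩ := hp k trivial
  have hp0 : 0 < p k := by linarith
  have hq0 : 0 < 1 - p k := by linarith
  have he := Real.exp_one_gt_d9
  have he' := Real.exp_one_lt_d9
  have hpos := Real.exp_pos 1
  have he2 : Real.exp 2 ≤ 9 := by
    rw [show (2 : ℝ) = 1 + 1 by norm_num, Real.exp_add]
    nlinarith
  have he3 : 19 ≤ Real.exp 3 := by
    rw [show (3 : ℝ) = 1 + 1 + 1 by norm_num, Real.exp_add, Real.exp_add]
    calc (19 : ℝ) ≤ 2.7 * 2.7 * 2.7 := by norm_num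
      _ ≤ _ := by gcongr <;> linarith
  have heq : logOdds (mixedProfile p) k = Real.log (p k / (1 - p k)) := by
    simp [logOdds, mixedProfile, Real.log_div hp0.ne' hq0.ne']
  rw [heq, Set.mem_Icc, Real.le_log_iff_exp_le (by positivity), Real.log_le_iff_le_exp (by positivity),
    le_div_iff₀ hq0, div_le_iff₀ hq0]
  -- `e ^ 2 ≤ 9` and `19 ≤ e ^ 3`, where `9` and `19` are the odds at the ends of the interval.
  constructor <;> nlinarith

theorem explorationForces_riskGame {a c : ℝ} (ha : 0 < a) (hc : 0 < c) {R : ℝ → Prop}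
    (hR : R (a / c)) :
    ExplorationForces (riskGame a c) initialBox (fun _ => 1 / 8) (fun _ => 8) R := by
  intro b B hb hbB s hs
  have hB : 0 ≤ B := hb.le.trans hbB
  set T₁ : ℝ := (3 + (B + 1) * s) / b with hT₁
  set T₂ : ℝ := 4 * (3 + (B + 1) * (s + T₁)) / b with hT₂
  have h1 : 0 < T₁ := by positivity
  have h2 : 0 < T₂ := by positivity
  refine ⟨T₁ + T₂, by positivity, ?_⟩
  intro P Q hP hQ hPv hQv hPd hQD p hp x y hx hx0 hy hy0
  have hbox := logOdds_mem_Icc_of_mem_initialBox hp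
  refine limitingRatio_riskGame ha hc hx hy
    (hx.isLogOddsPath.tendsto_atTop hb hP hPv hPd fun k => ?_)
    (hy.isLogOddsPath.tendsto_atBot hb hQ hQv (by positivity : 0 ≤ s + (T₁ + T₂))
      (hy.isLogOddsPath.le_quarter_of_exploresDuring hb hQ hB (by norm_num) (fun k => ?_) hs h1.le
        h2.le (mul_div_cancel₀ _ hb.ne').ge (mul_div_cancel₀ _ hb.ne').ge hQD)) hR
  · rw [hx0]
    exact (hbox k).1
  · rw [hy0]
    exact (hbox k).2

theorem exists_isSQLTrajectory (a c : ℝ) (P : Policy (Fin 2)) (hP : P.IsRegular) {B : ℝ}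
    (hB : ∀ k t, P.β k t ≤ B) {p : Fin 2 → ℝ} (hp : ∀ k, 0 < p k ∧ p k < 1) :
    ∃ x, IsSQLTrajectory (riskGame a c) P x ∧ x 0 = mixedProfile p := by
  obtain ⟨z, hz0, hz⟩ := exists_isLogOddsPath P hP hB (logOdds (mixedProfile p))
  refine ⟨_, hz.isSQLTrajectory a c, ?_⟩
  simp only [hz0]
  refine mixedProfile_sigmoid_logOdds (fun k i => ?_) fun k => ?_
  · fin_cases i <;> simp [mixedProfile, (hp k).1, (hp k).2]
  · simp [mixedProfile]

/-- Agent `k` explores at rate `8` until time `T + 1 / 2`; the exploration then falls linearly and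
vanishes at time `T + 1`. The other agent does not explore. The adaptation rate `1 / 16` is small
enough for a memory-loss rate of `1 / 2` to amount to the exploration rate `8`. -/
noncomputable def explorationPhase (k : Fin 2) (T : ℝ) : Policy (Fin 2) where
  α j t := if j = k then max 0 (min (1 / 2) (T + 1 - t)) else 0
  β _ _ := 1 / 16
  α_nonneg j t := by
    split_ifs
    · exact le_max_left _ _
    · exact le_rfl
  β_pos _ _ := by norm_num

/-- No agent ever explores. The adaptation rate is that of `explorationPhase`. -/
noncomputable def pureExploitation : Policy (Fin 2) where
  α _ _ := 0
  β _ _ := 1 / 16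
  α_nonneg _ _ := le_rfl
  β_pos _ _ := by norm_num

theorem singleAgentSuffices_riskGame {a c : ℝ} {R : ℝ → Prop}
    (hforce : ExplorationForces (riskGame a c) initialBox (fun _ => 1 / 8) (fun _ => 8) R) :
    SingleAgentSuffices (riskGame a c) initialBox (fun _ => 1 / 8) (fun _ => 8) R := by
  intro k
  obtain ⟨T, hT, hTf⟩ := hforce (1 / 16) (1 / 16) (by norm_num) le_rfl 0 le_rfl
  set P := pureExploitation
  set Q := explorationPhase k T with hQ
  have hPr : P.IsRegular := fun j =>
    ⟨continuous_const, continuous_const, fun t => by norm_num [P, pureExploitation]⟩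
  have hQr : Q.IsRegular := by
    intro j
    refine ⟨?_, continuous_const, fun t => ?_⟩
    · show Continuous fun t => if j = k then max 0 (min (1 / 2) (T + 1 - t)) else 0
      split_ifs <;> fun_prop
    · show (if j = k then max 0 (min (1 / 2) (T + 1 - t)) else 0) < 1
      split_ifs
      · exact max_lt one_pos ((min_le_left _ _).trans_lt (by norm_num))
      · exact one_pos
  have hPrate : ∀ j t, P.rate j t = 0 := fun j t => zero_div _
  have hPv : P.Vanishes := fun j => by
    simp only [show P.rate j = fun _ => 0 from funext (hPrate j), tendsto_const_nhds]
  have hQv : Q.Vanishes := by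
    intro j
    refine tendsto_const_nhds.congr' ?_
    filter_upwards [eventually_ge_atTop (T + 1)] with t ht
    have h0 : Q.α j t = 0 := by
      show (if j = k then max 0 (min (1 / 2) (T + 1 - t)) else 0) = 0
      split_ifs
      · exact max_eq_left ((min_le_right _ _).trans (by linarith))
      · rfl
    rw [Policy.rate, h0, zero_div]
  have hPd : P.StaysBelow fun _ => 1 / 8 := fun j t _ => by
    rw [hPrate]
    norm_num
  have hQk : ∀ t, t ≤ T → 8 ≤ Q.rate k t := by
    intro t ht
    have h0 : Q.α k t = 1 / 2 := by
      show (if k = k then max 0 (min (1 / 2) (T + 1 - t)) else 0) = 1 / 2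
      rw [if_pos rfl, min_eq_left (by linarith)]
      norm_num
    show 8 ≤ Q.α k t / (1 / 16)
    rw [h0]
    norm_num
  refine ⟨P, Q, hPr, hQr, rfl, fun j hj => funext fun t => if_neg hj, hPv, hQv, hPd,
    ⟨0, le_rfl, hQk 0 hT.le⟩, fun p hp => ?_⟩
  have hp' := pos_and_lt_one_of_mem_initialBox hp
  obtain ⟨x, hx, hx0⟩ := exists_isSQLTrajectory a c P hPr (fun _ _ => le_rfl) hp'
  obtain ⟨y, hy, hy0⟩ := exists_isSQLTrajectory a c Q hQr (fun _ _ => le_rfl) hp'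
  exact ⟨x, y, hx, hx0, hy, hy0, hTf P Q (fun _ _ _ => ⟨le_rfl, le_rfl⟩)
    (fun _ _ _ => ⟨le_rfl, le_rfl⟩) hPv hQv hPd ⟨k, fun t _ ht => hQk t (by linarith)⟩
    p hp x y hx hx0 hy hy0⟩

theorem theorem4p1 (M : ℝ) (hM : 0 < M) :
    ∃ (u v : Game (Fin 2) (Fin 2)) (Iu Iv : Set (Fin 2 → ℝ)) (d D : Fin 2 → ℝ),
      (IsPotentialGame u ∧ IsSymmetricGame u ∧ IsCoordinationGame u) ∧
      (IsPotentialGame v ∧ IsSymmetricGame v ∧ IsCoordinationGame v) ∧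
      (MeasurableSet Iu ∧ 0 < volume Iu ∧ ∀ p ∈ Iu, ∀ k, 0 < p k ∧ p k < 1) ∧
      (MeasurableSet Iv ∧ 0 < volume Iv ∧ ∀ p ∈ Iv, ∀ k, 0 < p k ∧ p k < 1) ∧
      (∀ k, 0 < d k ∧ d k ≤ D k) ∧
      ExplorationForces u Iu d D (fun r => M ≤ r) ∧
      ExplorationForces v Iv d D (fun r => r ≤ 1 / M) ∧
      SingleAgentSuffices u Iu d D (fun r => M ≤ r) ∧
      SingleAgentSuffices v Iv d D (fun r => r ≤ 1 / M) := by
  have hgame : ∀ a c, IsPotentialGame (riskGame a c) ∧ IsSymmetricGame (riskGame a c) ∧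
      IsCoordinationGame (riskGame a c) := fun a c =>
    ⟨isPotentialGame_riskGame a c, isSymmetricGame_riskGame a c, isCoordinationGame_riskGame a c⟩
  have hbox : MeasurableSet initialBox ∧ 0 < volume initialBox ∧
      ∀ p ∈ initialBox, ∀ k, 0 < p k ∧ p k < 1 :=
    ⟨measurableSet_initialBox, volume_initialBox_pos, fun _ => pos_and_lt_one_of_mem_initialBox⟩
  have hu := explorationForces_riskGame (R := fun r => M ≤ r) hM one_pos (div_one M).ge
  have hv := explorationForces_riskGame (R := fun r => r ≤ 1 / M) one_pos hM le_rfl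
  exact ⟨riskGame M 1, riskGame 1 M, initialBox, initialBox, fun _ => 1 / 8, fun _ => 8,
    hgame M 1, hgame 1 M, hbox, hbox, fun _ => by norm_num, hu, hv,
    singleAgentSuffices_riskGame hu, singleAgentSuffices_riskGame hv⟩
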